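/- Let $G$ be an undirected graph on the vertices $1,\dots,n$, let $1\le k\le n/2$, and put $\alpha=k/n$. For a vertex set $S$ let $f(S)$ be the number of vertices that have at least one neighbour on the other side of the partition $(S,V\setminus S)$ (the integrated vertices when $S$ is occupied by type-1 agents and $V\setminus S$ by type-2 agents), and let $\mathrm{OPT}=\max_{|S|=k} f(S)$. Let $$\alpha_{GW}=\inf_{-1\le z<1}\frac{\arccos(z)/\pi}{(1-z)/2},\qquad \beta=\frac1{4(\alpha-\alpha^2)},\qquad a=\frac{(1+\beta)-(1-\epsilon)2\alpha_{GW}}{1+\beta-2\alpha_{GW}},\qquad L=\Big\lceil \log_a\frac1\epsilon\Big\rceil .$$ Algorithm. Let $y_1,\dots,y_n\in\mathbb R^n$ be an optimal solution of the relaxation $$\text{maximize }\sum_{i}\max_{j\in N(i)}\frac{1-y_i\cdot y_j}{2}\quad\text{subject to}\quad \sum_{i<j}y_i\cdot y_j\le\frac{(1-2\alpha)^2n^2-n}{2},\quad y_i\cdot y_i=1\ \text{ for all } i$$ (an empty maximum counts as $0$). One round consists of two steps. (i) Rounding: draw a standard Gaussian vector $r\in\mathbb R^n$ and set $V_1=\{i: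 y_i\cdot r\ge 0\}$. (ii) Size fixing: if $|V_1|\ge k$, remove vertices from $V_1$ one at a time, each time a vertex $i$ of the current set $S$ that maximizes $f(S\setminus\{i\})-f(S)$, until $k$ vertices remain; these are the type-1 vertices. If $|V_1|<k$, proceed symmetrically from $V\setminus V_1$: either exchange the names of the two sides and remove vertices until $k$ remain, or move vertices out of $V\setminus V_1$ until $n-k$ remain, the others then being the type-1 vertices. Ties are broken in any way. The algorithm performs $L$ independent rounds and returns a result with the largest value of $f$. Theorem. Let $$\gamma=\sqrt{\alpha(1-\alpha)(1-\epsilon)2\alpha_{GW}},\qquad \rho(\alpha,\epsilon)=\frac{\alpha\Big((1-\epsilon)2\alpha_{GW}-\frac{\gamma-\gamma^2}{\alpha-\alpha^2}\Big)}{\gamma}\,(1-\epsilon).$$ 1. $\alpha_{GW}\ge 0.878567$. 2. For all sufficiently small $\epsilon>0$ (that is, for $0<\epsilon\le\epsilon_0$ with an absolute constant $\epsilon_0>0$), all $n$, $k$ and $G$ as above, every optimal solution $y$, every way of breaking ties and every $K\ge1$, the best result $T$ of $K$ independent executions of the algorithm ($KL$ rounds) satisfies $$\Pr\big[f(T)\ge\rho(\alpha,\epsilon)\,\mathrm{OPT}\big]\ge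 1-\epsilon^K\qquad\text{and}\qquad \mathbb E[f(T)]\ge\rho(\alpha,\epsilon)\,\mathrm{OPT}.$$ In particular ($K=1$) the algorithm itself attains the ratio $\rho(\alpha,\epsilon)$ in expectation, and with probability at least $1-\epsilon$. 3. $\rho(\alpha,\epsilon)>1/2$ for all real $\alpha\in[0.403,0.5]$ and all $0<\epsilon\le 10^{-3}$. -/

import Mathlib

open MeasureTheory ProbabilityTheory

namespace IntegrationMax

noncomputable section

/-- The set of integrated vertices when the vertices of `S` are of type 1 and all the others of
type 2: the vertices with at least one neighbour of the other type. -/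
def integrated {n : ℕ} (G : SimpleGraph (Fin n)) (S : Finset (Fin n)) : Finset (Fin n) :=
  open Classical in
  Finset.univ.filter fun u => ∃ v, G.Adj u v ∧ ¬(u ∈ S ↔ v ∈ S)

/-- The index of integration `f(S)`. -/
def index {n : ℕ} (G : SimpleGraph (Fin n)) (S : Finset (Fin n)) : ℕ :=
  (integrated G S).card

/-- The optimal index over all assignments with exactly `k` vertices of type 1. -/
def opt {n : ℕ} (G : SimpleGraph (Fin n)) (k : ℕ) : ℕ :=
  (Finset.univ.powersetCard k).sup (index G)

/-- The objective `∑ i, max_{j ∈ N(i)} (1 - yᵢ ⬝ yⱼ) / 2`. The supremum is over a finite set; an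
isolated vertex contributes `0`. -/
def sdpObjective {n : ℕ} (G : SimpleGraph (Fin n)) (y : Fin n → EuclideanSpace ℝ (Fin n)) : ℝ :=
  ∑ i, ⨆ j : {j : Fin n // G.Adj i j}, (1 - inner ℝ (y i) (y j)) / 2

/-- The constraints of the relaxation: unit vectors whose pairwise inner products over `i < j` sum
to at most `((1 - 2α)² n² - n) / 2`. -/
def SDPFeasible {n : ℕ} (α : ℝ) (y : Fin n → EuclideanSpace ℝ (Fin n)) : Prop :=
  (∀ i, inner ℝ (y i) (y i) = (1 : ℝ)) ∧
    ∑ i, ∑ j ∈ Finset.Ioi i, inner ℝ (y i) (y j) ≤ ((1 - 2 * α) ^ 2 * (n : ℝ) ^ 2 - n) / 2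

/-- `y` is an optimal solution of the relaxation. -/
def SDPOptimal {n : ℕ} (G : SimpleGraph (Fin n)) (α : ℝ)
    (y : Fin n → EuclideanSpace ℝ (Fin n)) : Prop :=
  SDPFeasible α y ∧ ∀ y', SDPFeasible α y' → sdpObjective G y' ≤ sdpObjective G y

/-- Hyperplane rounding: the set `V₁` of the vertices `i` with `yᵢ ⬝ r ≥ 0`. -/
def hyperplaneRound {n : ℕ} (y : Fin n → EuclideanSpace ℝ (Fin n))
    (r : EuclideanSpace ℝ (Fin n)) : Finset (Fin n) :=
  open Classical in
  Finset.univ.filter fun i => 0 ≤ (inner ℝ (y i) r : ℝ)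

/-- One greedy step: a vertex `i` of `S` is moved to the other side, where `i` maximizes
`f(S \ {i}) - f(S)` over `S`. Ties may be broken in any way. -/
def GreedyMove {n : ℕ} (G : SimpleGraph (Fin n)) (S T : Finset (Fin n)) : Prop :=
  ∃ i ∈ S, T = S.erase i ∧
    ∀ j ∈ S, (index G (S.erase j) : ℤ) - index G S ≤ (index G (S.erase i) : ℤ) - index G S

/-- `T` is a possible result of greedy size-fixing, started from the partition `(S, Sᶜ)`: vertices
are greedily moved out of `S` until `k` are left. If `S` has fewer than `k` vertices, its
complement has more than `n - k` of them, and plays the role of `S`: either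
the two sides are first exchanged (then `k` vertices remain in the shrinking side), or vertices
are moved out of the complement until `n - k` are left. Both variants are allowed. -/
def FixSize {n : ℕ} (G : SimpleGraph (Fin n)) (k : ℕ) (S T : Finset (Fin n)) : Prop :=
  T.card = k ∧
    ((k ≤ S.card ∧ Relation.ReflTransGen (GreedyMove G) S T) ∨
      (S.card < k ∧ (Relation.ReflTransGen (GreedyMove G) Sᶜ T ∨
        Relation.ReflTransGen (GreedyMove G) Sᶜ Tᶜ)))

/-- `T` is a possible output of `M` rounds with the normal vectors `r 0, …, r (M - 1)`: each round
rounds `y` along its normal vector and fixes the size, and `T` has the largest index of integration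
among the `M` results. -/
def BestOfRounds {n : ℕ} (G : SimpleGraph (Fin n)) (k : ℕ) (y : Fin n → EuclideanSpace ℝ (Fin n))
    {M : ℕ} (r : Fin M → EuclideanSpace ℝ (Fin n)) (T : Finset (Fin n)) : Prop :=
  ∃ R : Fin M → Finset (Fin n), (∀ l, FixSize G k (hyperplaneRound y (r l)) (R l)) ∧
    ∃ l, R l = T ∧ ∀ l', index G (R l') ≤ index G T

/-- The Goemans–Williamson constant: the largest `c` with `arccos z / π ≥ c (1 - z) / 2` for all
`z ∈ [-1, 1]`. -/
def gwConst : ℝ :=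
  sInf ((fun z : ℝ => (Real.arccos z / Real.pi) / ((1 - z) / 2)) '' Set.Ico (-1) 1)

/-- `β = 1 / (4 (α - α²))`. -/
def betaConst (α : ℝ) : ℝ := 1 / (4 * (α - α ^ 2))

/-- The base `a` of the logarithm in the number of rounds. -/
def logBase (α ε : ℝ) : ℝ :=
  ((1 + betaConst α) - (1 - ε) * (2 * gwConst)) / (1 + betaConst α - 2 * gwConst)

/-- The number of rounds `L = ⌈log_a (1 / ε)⌉`. -/
def numRounds (α ε : ℝ) : ℕ := ⌈Real.logb (logBase α ε) (1 / ε)⌉₊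

/-- `γ = √(α (1 - α) (1 - ε) 2 α_GW)`. -/
def gammaConst (α ε : ℝ) : ℝ := Real.sqrt (α * (1 - α) * (1 - ε) * (2 * gwConst))

/-- The approximation ratio. -/
def ratio (α ε : ℝ) : ℝ :=
  α * ((1 - ε) * (2 * gwConst) - (gammaConst α ε - gammaConst α ε ^ 2) / (α - α ^ 2)) /
    gammaConst α ε * (1 - ε)

end

end IntegrationMax

namespace IntegrationMax

/-! ### Taylor bounds for sine and cosine -/

/-! Write g for `gwConst`, V for the rounded set, d for the size of the side that size fixing
shrinks, δ = d/n. Since (1-ε)2g = γ²/(α(1-α)), the ratio simplifies to (2γ-1)/(1-α)·(1-ε)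
(`ratio_eq`).

Size fixing: an integrated vertex is lost by the removal of at most one vertex of S, so the best
removal keeps at least the fraction 1 - 1/|S| of f(S). The product telescopes to f(T) ≥ f(V)k/d
(`FixSize.index_mul_le`). Hence the ratio without its factor 1-ε is reached as soon as f(V)/d is
large enough; this is `GoodSet`.

Rounding: two unit vectors at angle θ are separated in a prescribed order with probability at least
θ/(2π), by rotation invariance of the Gaussian plane. Together with the relaxation bound OPT ≤
`sdpObjective` and the balance constraint this gives E f(V) ≥ g·OPT and E |V||Vᶜ| ≥ g·α(1-α)n².

One round: consider W = α(1-α)f(V)/OPT + 0.99·|V||Vᶜ|/n². With x = γ at ε = 0, its mean is at least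
1.99x²/2. If V is not good, W is at most (2γ-1)δ + 0.99δ(1-δ), whose maximum over δ is at most
(2x-0.01)²/3.96. With coefficient 1 in place of 0.99 the two bounds would both be x² at ε = 0.
Lowering the coefficient from 1 decreases the maximum at rate x - x² and the mean at rate x²/2,
which is a gain exactly for x < 2/3; and x² ≤ 0.44 because g ≤ 0.88. So there is an absolute gap. As
W exceeds the bad bound by at most 2 on good sets, a round is good with probability at least 10⁻⁵,
whatever ε is (`le_measureReal_goodSet`).

Amplification: for small ε the base a of the logarithm is at most 1/0.99999, so L rounds all fail
with probability at most a^(-L) ≤ ε. Markov's inequality gives the expectation, at the cost of the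
factor 1-ε. -/

lemma nonneg_of_hasDerivAt_nonneg {f f' : ℝ → ℝ} (hf : ∀ x, HasDerivAt f (f' x) x)
    (h0 : f 0 = 0) (hf' : ∀ x, 0 ≤ x → 0 ≤ f' x) {x : ℝ} (hx : 0 ≤ x) : 0 ≤ f x := by
  have hmono : MonotoneOn f (Set.Ici 0) := by
    refine monotoneOn_of_deriv_nonneg (convex_Ici 0)
      (fun y _ => (hf y).continuousAt.continuousWithinAt)
      (fun y _ => (hf y).differentiableAt.differentiableWithinAt) fun y hy => ?_
    rw [interior_Ici] at hy
    rw [(hf y).deriv]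
    exact hf' y (le_of_lt hy)
  simpa [h0] using hmono (Set.mem_Ici.2 le_rfl) (Set.mem_Ici.2 hx) hx

/-- The Taylor polynomial of cosine with `n` terms. -/
noncomputable def cosTaylor (n : ℕ) (x : ℝ) : ℝ :=
  ∑ k ∈ Finset.range n, (-1) ^ k * (x ^ (2 * k) / (2 * k).factorial)

/-- The Taylor polynomial of sine with `n` terms. -/
noncomputable def sinTaylor (n : ℕ) (x : ℝ) : ℝ :=
  ∑ k ∈ Finset.range n, (-1) ^ k * (x ^ (2 * k + 1) / (2 * k + 1).factorial)

lemma hasDerivAt_pow_div_factorial (m : ℕ) (x : ℝ) :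
    HasDerivAt (fun x : ℝ => x ^ (m + 1) / (m + 1).factorial) (x ^ m / m.factorial) x := by
  refine ((hasDerivAt_pow (m + 1) x).div_const ((m + 1).factorial : ℝ)).congr_deriv ?_
  rw [Nat.factorial_succ]
  push_cast
  field_simp

lemma hasDerivAt_sinTaylor (n : ℕ) (x : ℝ) :
    HasDerivAt (sinTaylor n) (cosTaylor n x) x := by
  unfold sinTaylor cosTaylor
  exact HasDerivAt.fun_sum fun k _ => (hasDerivAt_pow_div_factorial (2 * k) x).const_mul _

lemma hasDerivAt_cosTaylor (n : ℕ) (x : ℝ) :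
    HasDerivAt (cosTaylor (n + 1)) (-sinTaylor n x) x := by
  have h : cosTaylor (n + 1) = fun x => (∑ k ∈ Finset.range n,
      (-1 : ℝ) ^ (k + 1) * (x ^ (2 * k + 1 + 1) / (2 * k + 1 + 1).factorial)) + 1 := by
    funext y
    simp [cosTaylor, Finset.sum_range_succ', mul_add]
  rw [h]
  have h2 : -sinTaylor n x = ∑ k ∈ Finset.range n,
      (-1 : ℝ) ^ (k + 1) * (x ^ (2 * k + 1) / (2 * k + 1).factorial) := by
    simp [sinTaylor, pow_succ]
  rw [h2]
  exact (HasDerivAt.fun_sum fun k _ =>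
    (hasDerivAt_pow_div_factorial (2 * k + 1) x).const_mul _).add_const _

lemma sin_taylor_of_cos_taylor {n : ℕ}
    (h : ∀ x : ℝ, 0 ≤ x → 0 ≤ (-1) ^ n * (Real.cos x - cosTaylor n x)) {x : ℝ} (hx : 0 ≤ x) :
    0 ≤ (-1) ^ n * (Real.sin x - sinTaylor n x) :=
  nonneg_of_hasDerivAt_nonneg
    (fun y => ((Real.hasDerivAt_sin y).sub (hasDerivAt_sinTaylor n y)).const_mul _)
    (by simp [sinTaylor]) h hx

/-- Each remainder vanishes at 0, and differentiating leads from cosine to sine to the previous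
cosine remainder with a change of sign; the induction starts from cos ≤ 1. -/
lemma cos_taylor (n : ℕ) :
    ∀ x : ℝ, 0 ≤ x → 0 ≤ (-1) ^ (n + 1) * (Real.cos x - cosTaylor (n + 1) x) := by
  induction n with
  | zero => intro x _; simp [cosTaylor, Real.cos_le_one]
  | succ n ih =>
    intro x hx
    refine nonneg_of_hasDerivAt_nonneg
      (fun y => ((Real.hasDerivAt_cos y).sub (hasDerivAt_cosTaylor (n + 1) y)).const_mul _)
      ?_ (fun y hy => ?_) hx
    · simp [cosTaylor, Finset.sum_range_succ']
    · have := sin_taylor_of_cos_taylor ih hy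
      rw [pow_succ]
      linarith

lemma sin_taylor (n : ℕ) {x : ℝ} (hx : 0 ≤ x) :
    0 ≤ (-1) ^ (n + 1) * (Real.sin x - sinTaylor (n + 1) x) :=
  sin_taylor_of_cos_taylor (cos_taylor n) hx

/-! ### Bounds for the Goemans–Williamson constant -/

/-- Concavity of cosine on [0, π/2]: the gap to the tangent at x has derivative sin z - sin x, so it
is smallest at z = x. -/
lemma cos_le_tangent {x y : ℝ} (hx : 0 ≤ x) (hx' : x ≤ Real.pi / 2) (hy : 0 ≤ y)
    (hy' : y ≤ Real.pi / 2) : Real.cos y ≤ Real.cos x - Real.sin x * (y - x) := by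
  have key : ∀ z, HasDerivAt (fun z => Real.cos x - Real.sin x * (z - x) - Real.cos z)
      (Real.sin z - Real.sin x) z := fun z => by
    refine (((((hasDerivAt_id z).sub_const x).const_mul (Real.sin x)).const_sub
      (Real.cos x)).sub (Real.hasDerivAt_cos z)).congr_deriv ?_
    ring
  rcases le_total x y with h | h
  · have hmono : MonotoneOn (fun z => Real.cos x - Real.sin x * (z - x) - Real.cos z)
        (Set.Icc x y) := by
      refine monotoneOn_of_deriv_nonneg (convex_Icc x y)
        (fun z _ => (key z).continuousAt.continuousWithinAt)
        (fun z _ => (key z).differentiableAt.differentiableWithinAt) fun z hz => ?_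
      rw [interior_Icc] at hz
      rw [(key z).deriv, sub_nonneg]
      exact Real.sin_le_sin_of_le_of_le_pi_div_two (by linarith) (by linarith [hz.2]) hz.1.le
    have := hmono (Set.left_mem_Icc.2 h) (Set.right_mem_Icc.2 h) h
    simp only [sub_self, mul_zero, sub_zero] at this
    linarith
  · have hanti : AntitoneOn (fun z => Real.cos x - Real.sin x * (z - x) - Real.cos z)
        (Set.Icc y x) := by
      refine antitoneOn_of_deriv_nonpos (convex_Icc y x)
        (fun z _ => (key z).continuousAt.continuousWithinAt)
        (fun z _ => (key z).differentiableAt.differentiableWithinAt) fun z hz => ?_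
      rw [interior_Icc] at hz
      rw [(key z).deriv, sub_nonpos]
      exact Real.sin_le_sin_of_le_of_le_pi_div_two (by linarith [hz.1]) hx' hz.2.le
    have := hanti (Set.left_mem_Icc.2 h) (Set.right_mem_Icc.2 h) h
    simp only [sub_self, mul_zero, sub_zero] at this
    linarith

/-- The point approximates π - θ, where θ ≈ 2.331122 minimizes the Goemans–Williamson quotient. As
0.878567 is nearly sharp, the tangent has to be taken very close to it. -/
lemma sin_cos_near_minimizer :
    Real.cos 0.81047053 ≤ 0.6891576 ∧ 0.7246115 ≤ Real.sin 0.81047053 ∧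
      Real.sin 0.81047053 ≤ 0.7246116 := by
  have h1 := cos_taylor 4 0.81047053 (by norm_num)
  have h2 := sin_taylor 4 (x := 0.81047053) (by norm_num)
  have h3 := sin_taylor 5 (x := 0.81047053) (by norm_num)
  simp only [cosTaylor, sinTaylor, Finset.sum_range_succ, Finset.sum_range_zero] at h1 h2 h3
  norm_num [Nat.factorial] at h1 h2 h3
  refine ⟨by linarith, by linarith, by linarith⟩

lemma gw_trig_inequality {x : ℝ} (hx : 0 ≤ x) (hx' : x ≤ Real.pi / 2) :
    0.878567 * Real.pi / 2 * (1 + Real.cos x) ≤ Real.pi - x := by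
  have hp1 := Real.pi_gt_d20
  have hp2 := Real.pi_lt_d20
  obtain ⟨hc, hs1, hs2⟩ := sin_cos_near_minimizer
  have ht := cos_le_tangent (x := 0.81047053) (by norm_num) (by linarith) hx hx'
  set p := Real.pi
  -- The slack absorbs the uncertainty 10⁻⁷ in the slope, multiplied by a distance below 1.
  have hb : Real.cos x ≤ 0.6891576 - 0.7246115 * (x - 0.81047053) + 0.0000002 := by
    have : x < 1.6 := by linarith
    rcases le_total 0.81047053 x with h | h <;> nlinarith
  have : 0.878567 * p / 2 * (1 + Real.cos x) ≤ 0.878567 * p / 2 *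
      (1 + (0.6891576 - 0.7246115 * (x - 0.81047053) + 0.0000002)) := by gcongr
  nlinarith

lemma gw_arccos_inequality {z : ℝ} (hz : z ∈ Set.Icc (-1 : ℝ) 1) :
    0.878567 * Real.pi / 2 * (1 - z) ≤ Real.arccos z := by
  have hpi := Real.pi_pos
  have hcos := Real.cos_arccos hz.1 hz.2
  have h0 := Real.arccos_nonneg z
  have h1 := Real.arccos_le_pi z
  -- For acute angles Jordan's inequality makes the quotient at least 1. For obtuse ones, x = π -
  -- arccos z lies in [0, π/2].
  rcases le_total (Real.arccos z) (Real.pi / 2) with h | h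
  · have := Real.one_sub_mul_le_cos h0 h
    rw [hcos] at this
    have h2 : 1 - z ≤ 2 / Real.pi * Real.arccos z := by linarith
    calc 0.878567 * Real.pi / 2 * (1 - z)
        ≤ 0.878567 * Real.pi / 2 * (2 / Real.pi * Real.arccos z) := by gcongr
      _ = 0.878567 * Real.arccos z := by field_simp
      _ ≤ Real.arccos z := by linarith
  · have := gw_trig_inequality (x := Real.pi - Real.arccos z) (by linarith) (by linarith)
    rw [Real.cos_pi_sub, hcos] at this
    simpa [sub_eq_add_neg] using this

lemma gwConst_ge : (0.878567 : ℝ) ≤ gwConst := by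
  refine le_csInf ⟨_, -1, by norm_num, rfl⟩ ?_
  rintro _ ⟨z, ⟨hz1, hz2⟩, rfl⟩
  have h := gw_arccos_inequality ⟨hz1, hz2.le⟩
  have hpi := Real.pi_pos
  dsimp only
  rw [le_div_iff₀ (by linarith), le_div_iff₀ hpi]
  linarith

lemma gwConst_mul_le {z : ℝ} (hz : z ∈ Set.Icc (-1 : ℝ) 1) :
    gwConst * ((1 - z) / 2) ≤ Real.arccos z / Real.pi := by
  rcases hz.2.eq_or_lt with rfl | h
  · simp
  · rw [← le_div_iff₀ (by linarith)]
    refine csInf_le ⟨0, ?_⟩ ⟨z, ⟨hz.1, h⟩, rfl⟩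
    rintro _ ⟨w, hw, rfl⟩
    have : 0 < 1 - w := by linarith [hw.2]
    have := Real.arccos_nonneg w
    have := Real.pi_pos
    dsimp only
    positivity

/-- The angle 3π/4 is close enough to the minimizer: its quotient is about 0.8787. -/
lemma gwConst_le : gwConst ≤ 0.88 := by
  have h2 : (1.414 : ℝ) < √2 := Real.lt_sqrt_of_sq_lt (by norm_num)
  have h3 : √2 < (1.415 : ℝ) := by rw [Real.sqrt_lt' (by norm_num)]; norm_num
  have h := gwConst_mul_le (z := -(√2 / 2)) ⟨by linarith, by linarith⟩
  have hac : Real.arccos (-(√2 / 2)) = 3 * Real.pi / 4 := by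
    rw [Real.arccos_neg, ← Real.cos_pi_div_four, Real.arccos_cos (by positivity)
      (by linarith [Real.pi_pos])]
    ring
  have hpi := Real.pi_pos
  rw [hac, show 3 * Real.pi / 4 / Real.pi = 3 / 4 by field_simp] at h
  by_contra! hc
  nlinarith

/-! ### The approximation ratio -/

lemma gammaConst_sq {α ε : ℝ} (h0 : 0 ≤ α) (h1 : α ≤ 1) (hε : ε ≤ 1) :
    gammaConst α ε ^ 2 = α * (1 - α) * (1 - ε) * (2 * gwConst) := by
  have := gwConst_ge
  have : 0 ≤ 1 - α := by linarith
  have : 0 ≤ 1 - ε := by linarith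
  exact Real.sq_sqrt (by positivity)

lemma gammaConst_pos {α ε : ℝ} (h0 : 0 < α) (h1 : α < 1) (hε : ε < 1) : 0 < gammaConst α ε := by
  have := gwConst_ge
  have : 0 < 1 - α := by linarith
  have : 0 < 1 - ε := by linarith
  exact Real.sqrt_pos.2 (by positivity)

lemma ratio_eq {α ε : ℝ} (h0 : 0 < α) (h1 : α < 1) (hε : ε < 1) :
    ratio α ε = (2 * gammaConst α ε - 1) / (1 - α) * (1 - ε) := by
  have hg := gammaConst_pos h0 h1 hε
  have hsq := gammaConst_sq h0.le h1.le hε.le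
  have h2 : 1 - α ≠ 0 := by linarith
  have hc : (1 - ε) * (2 * gwConst) = gammaConst α ε ^ 2 / (α * (1 - α)) := by
    rw [hsq]; field_simp
  have h3 : α - α ^ 2 = α * (1 - α) := by ring
  rw [ratio, hc, h3]
  field_simp
  ring

lemma half_lt_ratio {α ε : ℝ} (hα : α ∈ Set.Icc (0.403 : ℝ) 0.5) (hε : 0 < ε)
    (hε' : ε ≤ 1 / 1000) : 1 / 2 < ratio α ε := by
  obtain ⟨h1, h2⟩ := hα
  norm_num at h1 h2
  have hg := gwConst_ge
  rw [ratio_eq (by linarith) (by linarith) (by linarith)]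
  have hsq := gammaConst_sq (α := α) (ε := ε) (by linarith) (by linarith) (by linarith)
  have hγ := gammaConst_pos (α := α) (ε := ε) (by linarith) (by linarith) (by linarith)
  set γ := gammaConst α ε
  have hs : 1.755376 * (α * (1 - α)) ≤ γ ^ 2 := by
    rw [hsq]
    have h3 : 0.999 * (2 * 0.878567) ≤ (1 - ε) * (2 * gwConst) := by
      apply mul_le_mul <;> linarith
    have h4 : 0 ≤ α * (1 - α) := mul_nonneg (by linarith) (by linarith)
    nlinarith
  -- This is what 2γ - 1 > (1-α)/(2·0.999) asks of γ. The difference of the squared bounds is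
  -- concave in α, so the endpoints 0.403 and 0.5 decide.
  have hlow : 1 / 2 + (1 - α) / 3.996 < γ := by
    apply lt_of_pow_lt_pow_left₀ 2 hγ.le
    refine lt_of_lt_of_le ?_ hs
    have h7 : 0 ≤ (α - 0.403) * (0.5 - α) := mul_nonneg (by linarith) (by linarith)
    ring_nf at h7 ⊢
    linarith
  have h5 : (1 - α) / 2 < (2 * γ - 1) * (1 - ε) := by
    have : (1 - α) / 1.998 < 2 * γ - 1 := by norm_num at hlow ⊢; linarith
    have h6 : 0 < (1 - α) / 1.998 := by apply div_pos <;> linarith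
    calc (1 - α) / 2 = (1 - α) / 1.998 * 0.999 := by ring
      _ < (2 * γ - 1) * 0.999 := by gcongr
      _ ≤ _ := by gcongr <;> linarith
  rw [div_mul_eq_mul_div, lt_div_iff₀ (by linarith)]
  linarith

/-! ### The Gaussian measure of a double wedge -/

section Gaussian

variable {E : Type*} [NormedAddCommGroup E] [InnerProductSpace ℝ E] [FiniteDimensional ℝ E]
  [MeasurableSpace E] [BorelSpace E]

lemma map_inner_stdGaussian {u : E} (hu : ‖u‖ = 1) :
    (stdGaussian E).map (fun r => inner ℝ u r) = gaussianReal 0 1 := by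
  have h : HasGaussianLaw (fun r => inner ℝ u r) (stdGaussian E) :=
    (IsGaussian.hasGaussianLaw_id (μ := stdGaussian E)).map_fun (innerSL ℝ u)
  rw [h.map_eq_gaussianReal]
  have h1 : ∫ r, inner ℝ u r ∂(stdGaussian E) = 0 := integral_strongDual_stdGaussian (innerSL ℝ u)
  have h2 : Var[fun r => inner ℝ u r; stdGaussian E] = 1 := by
    have := variance_dual_stdGaussian (innerSL ℝ u)
    rw [innerSL_apply_norm, hu, one_pow] at this
    exact this
  rw [h1, h2, Real.toNNReal_one]

lemma map_inner_prod_stdGaussian {u w : E} (hu : ‖u‖ = 1) (hw : ‖w‖ = 1)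
    (huw : inner ℝ u w = (0 : ℝ)) :
    (stdGaussian E).map (fun r => ((inner ℝ u r : ℝ), (inner ℝ w r : ℝ))) =
      (gaussianReal 0 1).prod (gaussianReal 0 1) := by
  have h : HasGaussianLaw (fun r => ((inner ℝ u r : ℝ), (inner ℝ w r : ℝ))) (stdGaussian E) :=
    (IsGaussian.hasGaussianLaw_id (μ := stdGaussian E)).map_fun ((innerSL ℝ u).prod (innerSL ℝ w))
  have hcov : cov[fun r => inner ℝ u r, fun r => inner ℝ w r; stdGaussian E] = 0 := by
    rw [← covarianceBilin_apply_eq_cov IsGaussian.memLp_two_id, covarianceBilin_stdGaussian]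
    exact huw
  have hind := h.indepFun_of_covariance_eq_zero hcov
  rw [indepFun_iff_map_prod_eq_prod_map_map (by fun_prop) (by fun_prop)] at hind
  rw [hind, map_inner_stdGaussian hu, map_inner_stdGaussian hw]

end Gaussian

open scoped ENNReal

lemma gaussianPDF_mul_gaussianPDF_polar (ρ φ : ℝ) :
    gaussianPDF 0 1 (ρ * Real.cos φ) * gaussianPDF 0 1 (ρ * Real.sin φ) =
      gaussianPDF 0 1 0 * gaussianPDF 0 1 ρ := by
  simp only [gaussianPDF]
  rw [← ENNReal.ofReal_mul (gaussianPDFReal_nonneg _ _ _),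
    ← ENNReal.ofReal_mul (gaussianPDFReal_nonneg _ _ _)]
  congr 1
  simp only [gaussianPDFReal]
  rw [mul_mul_mul_comm, ← Real.exp_add, mul_mul_mul_comm _ (Real.exp _), ← Real.exp_add]
  congr 2
  have := Real.sin_sq_add_cos_sq φ
  push_cast
  linear_combination (-ρ ^ 2 / 2) * this

lemma gaussian_prod_apply {S : Set (ℝ × ℝ)} (hS : MeasurableSet S) :
    ((gaussianReal 0 1).prod (gaussianReal 0 1)) S =
      ∫⁻ p in Set.Ioi (0 : ℝ) ×ˢ Set.Ioo (-Real.pi) Real.pi, ENNReal.ofReal p.1 *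
        S.indicator (fun _ => gaussianPDF 0 1 0 * gaussianPDF 0 1 p.1)
          (p.1 * Real.cos p.2, p.1 * Real.sin p.2) := by
  rw [gaussianReal_of_var_ne_zero _ one_ne_zero,
    prod_withDensity (measurable_gaussianPDF 0 1) (measurable_gaussianPDF 0 1),
    withDensity_apply _ hS, ← lintegral_indicator hS, ← Measure.volume_eq_prod,
    ← lintegral_comp_polarCoord_symm]
  refine lintegral_congr fun p => ?_
  simp only [smul_eq_mul, polarCoord_symm_apply]
  by_cases h : (p.1 * Real.cos p.2, p.1 * Real.sin p.2) ∈ S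
  · rw [Set.indicator_of_mem h, Set.indicator_of_mem h, gaussianPDF_mul_gaussianPDF_polar]
  · rw [Set.indicator_of_notMem h, Set.indicator_of_notMem h]

/-- The radial part of a polar integral of the Gaussian density. -/
noncomputable def radialMass : ℝ≥0∞ :=
  ∫⁻ x in Set.Ioi (0 : ℝ), ENNReal.ofReal x * (gaussianPDF 0 1 0 * gaussianPDF 0 1 x)

lemma lintegral_sector (J : Set ℝ) :
    ∫⁻ p in Set.Ioi (0 : ℝ) ×ˢ J, ENNReal.ofReal p.1 *
        (gaussianPDF 0 1 0 * gaussianPDF 0 1 p.1) = radialMass * volume J := by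
  rw [Measure.volume_eq_prod, ← Measure.prod_restrict]
  have := lintegral_prod_mul (μ := volume.restrict (Set.Ioi (0 : ℝ))) (ν := volume.restrict J)
    (f := fun x => ENNReal.ofReal x * (gaussianPDF 0 1 0 * gaussianPDF 0 1 x)) (g := fun _ => 1)
    (by have := measurable_gaussianPDF 0 1; fun_prop) (by fun_prop)
  simpa [radialMass] using this

/-- The full circle has Gaussian mass 1, so the radial integral need not be computed. -/
lemma radialMass_mul : radialMass * ENNReal.ofReal (2 * Real.pi) = 1 := by
  have h := gaussian_prod_apply MeasurableSet.univ
  simp only [measure_univ, Set.indicator_univ] at h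
  rw [lintegral_sector, Real.volume_Ioo] at h
  rw [h]
  ring_nf

lemma measurableSet_wedge (a b : ℝ) :
    MeasurableSet {p : ℝ × ℝ | 0 ≤ p.1 ∧ a * p.1 + b * p.2 < 0} := by
  rw [Set.ofPred_and]
  exact (measurableSet_le (by fun_prop) (by fun_prop)).inter
    (measurableSet_lt (by fun_prop) (by fun_prop))

/-- In polar coordinates the wedge is cos φ ≥ 0, cos(θ - φ) < 0. It contains the sector -π/2 < φ < θ
- π/2, and a lower bound needs no more. -/
lemma le_gaussian_prod_wedge {θ : ℝ} (hπ : θ ≤ Real.pi) :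
    ENNReal.ofReal (θ / (2 * Real.pi)) ≤ ((gaussianReal 0 1).prod (gaussianReal 0 1))
      {p | 0 ≤ p.1 ∧ Real.cos θ * p.1 + Real.sin θ * p.2 < 0} := by
  have hpi := Real.pi_pos
  have hS := measurableSet_wedge (Real.cos θ) (Real.sin θ)
  rw [gaussian_prod_apply hS]
  have hsub : Set.Ioi (0 : ℝ) ×ˢ Set.Ioo (-(Real.pi / 2)) (θ - Real.pi / 2) ⊆
      Set.Ioi (0 : ℝ) ×ˢ Set.Ioo (-Real.pi) Real.pi :=
    Set.prod_mono_right (Set.Ioo_subset_Ioo (by linarith) (by linarith))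
  refine le_trans ?_ (lintegral_mono_set hsub)
  have hcongr : ∀ p ∈ Set.Ioi (0 : ℝ) ×ˢ Set.Ioo (-(Real.pi / 2)) (θ - Real.pi / 2),
      ENNReal.ofReal p.1 * Set.indicator
        {p : ℝ × ℝ | 0 ≤ p.1 ∧ Real.cos θ * p.1 + Real.sin θ * p.2 < 0}
        (fun _ => gaussianPDF 0 1 0 * gaussianPDF 0 1 p.1)
          (p.1 * Real.cos p.2, p.1 * Real.sin p.2) =
      ENNReal.ofReal p.1 * (gaussianPDF 0 1 0 * gaussianPDF 0 1 p.1) := by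
    rintro ⟨ρ, φ⟩ ⟨hρ, hφ1, hφ2⟩
    simp only [Set.mem_Ioi] at hρ hφ1 hφ2
    rw [Set.indicator_of_mem]
    refine ⟨mul_nonneg hρ.le (Real.cos_nonneg_of_mem_Icc ⟨hφ1.le, by linarith⟩), ?_⟩
    have hneg : Real.cos (θ - φ) < 0 :=
      Real.cos_neg_of_pi_div_two_lt_of_lt (by linarith) (by linarith)
    rw [Real.cos_sub] at hneg
    have := mul_neg_of_pos_of_neg hρ hneg
    dsimp only
    linarith
  rw [setLIntegral_congr_fun (measurableSet_Ioi.prod measurableSet_Ioo) hcongr,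
    lintegral_sector, Real.volume_Ioo]
  have hθ : θ - Real.pi / 2 - -(Real.pi / 2) = (2 * Real.pi) * (θ / (2 * Real.pi)) := by
    field_simp; ring
  rw [hθ, ENNReal.ofReal_mul (by positivity), ← mul_assoc, radialMass_mul, one_mul]

section Wedge

variable {E : Type*} [NormedAddCommGroup E] [InnerProductSpace ℝ E]

lemma exists_unit_orthogonal (hE : 2 ≤ Module.finrank ℝ E) {u : E} (hu : ‖u‖ = 1) :
    ∃ w : E, ‖w‖ = 1 ∧ inner ℝ u w = (0 : ℝ) := by
  have hu0 : u ≠ 0 := by rintro rfl; simp at hu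
  have : Fact (Module.finrank ℝ E = (Module.finrank ℝ E - 1) + 1) := ⟨by omega⟩
  have h := Submodule.finrank_orthogonal_span_singleton (𝕜 := ℝ)
    (n := Module.finrank ℝ E - 1) hu0
  have : Nontrivial (Submodule.span ℝ {u})ᗮ :=
    Module.nontrivial_of_finrank_pos (R := ℝ) (by omega)
  obtain ⟨w, hw⟩ := exists_norm_eq (Submodule.span ℝ {u})ᗮ (zero_le_one (α := ℝ))
  exact ⟨w, hw, Submodule.mem_orthogonal_singleton_iff_inner_right.1 w.2⟩

lemma exists_polar_decomposition (hE : 2 ≤ Module.finrank ℝ E) {u v : E} (hu : ‖u‖ = 1)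
    (hv : ‖v‖ = 1) : ∃ w : E, ‖w‖ = 1 ∧ inner ℝ u w = (0 : ℝ) ∧
      v = Real.cos (Real.arccos (inner ℝ u v)) • u + Real.sin (Real.arccos (inner ℝ u v)) • w := by
  have habs : |inner ℝ u v| ≤ (1 : ℝ) := by
    simpa [hu, hv] using abs_real_inner_le_norm u v
  rw [abs_le] at habs
  rw [Real.cos_arccos habs.1 habs.2]
  set z : ℝ := inner ℝ u v
  set s := Real.sin (Real.arccos z)
  have hs : s ^ 2 = 1 - z ^ 2 := by
    have := Real.sin_sq_add_cos_sq (Real.arccos z)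
    rw [Real.cos_arccos habs.1 habs.2] at this
    linarith
  have hnorm : ‖v - z • u‖ ^ 2 = s ^ 2 := by
    rw [norm_sub_sq_real, inner_smul_right, real_inner_comm, norm_smul, hu, hv, hs,
      Real.norm_eq_abs, mul_one, sq_abs]
    ring
  have hs0 : 0 ≤ s := Real.sin_nonneg_of_nonneg_of_le_pi (Real.arccos_nonneg _) (Real.arccos_le_pi _)
  have hnorm' : ‖v - z • u‖ = s := by
    rwa [sq_eq_sq₀ (norm_nonneg _) hs0] at hnorm
  -- If v = ±u, the direction of w is undetermined; dimension at least 2 supplies one.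
  rcases hs0.eq_or_lt with h | h
  · obtain ⟨w, hw, huw⟩ := exists_unit_orthogonal hE hu
    refine ⟨w, hw, huw, ?_⟩
    rw [← h, norm_eq_zero, sub_eq_zero] at hnorm'
    rw [← h, zero_smul, add_zero]
    exact hnorm'
  · refine ⟨s⁻¹ • (v - z • u), ?_, ?_, ?_⟩
    · rw [norm_smul, hnorm', Real.norm_eq_abs, abs_of_pos (inv_pos.2 h), inv_mul_cancel₀ h.ne']
    · rw [inner_smul_right, inner_sub_right, inner_smul_right, real_inner_self_eq_norm_sq, hu]
      simp [z]
    · rw [smul_smul, mul_inv_cancel₀ h.ne', one_smul, add_sub_cancel]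

lemma arccos_le_stdGaussian_wedge [FiniteDimensional ℝ E] [MeasurableSpace E] [BorelSpace E]
    (hE : 2 ≤ Module.finrank ℝ E) {u v : E} (hu : ‖u‖ = 1) (hv : ‖v‖ = 1) :
    Real.arccos (inner ℝ u v) / (2 * Real.pi) ≤
      (stdGaussian E).real {r | 0 ≤ (inner ℝ u r : ℝ) ∧ (inner ℝ v r : ℝ) < 0} := by
  obtain ⟨w, hw, huw, hvw⟩ := exists_polar_decomposition hE hu hv
  set θ := Real.arccos (inner ℝ u v)
  have h := le_gaussian_prod_wedge
    (Real.arccos_le_pi (inner ℝ u v))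
  have hS := measurableSet_wedge (Real.cos θ) (Real.sin θ)
  rw [← map_inner_prod_stdGaussian hu hw huw, Measure.map_apply (by fun_prop) hS] at h
  have hset : {r : E | 0 ≤ (inner ℝ u r : ℝ) ∧ (inner ℝ v r : ℝ) < 0} =
      (fun r => ((inner ℝ u r : ℝ), (inner ℝ w r : ℝ))) ⁻¹'
        {p : ℝ × ℝ | 0 ≤ p.1 ∧ Real.cos θ * p.1 + Real.sin θ * p.2 < 0} := by
    ext r
    simp only [Set.mem_ofPred_eq, Set.mem_preimage]
    nth_rewrite 1 [hvw]
    rw [inner_add_left, real_inner_smul_left, real_inner_smul_left]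
  rw [hset, measureReal_def]
  exact (ENNReal.ofReal_le_iff_le_toReal (measure_ne_top _ _)).1 h

end Wedge

/-! ### Greedy size fixing -/

section Greedy

variable {n : ℕ} (G : SimpleGraph (Fin n))

lemma mem_integrated {S : Finset (Fin n)} {u : Fin n} :
    u ∈ integrated G S ↔ ∃ v, G.Adj u v ∧ ¬(u ∈ S ↔ v ∈ S) := by
  simp [integrated]

lemma index_compl (S : Finset (Fin n)) : index G Sᶜ = index G S := by
  unfold index
  congr 1
  ext u
  simp [mem_integrated, not_iff_not]

/-- Fix one neighbour v of u across the partition. The edge uv stays cut unless its endpoint in S is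
the vertex removed. -/
lemma card_loss_le_one {S : Finset (Fin n)} {u : Fin n} (hu : u ∈ integrated G S) :
    (S.filter fun i => u ∉ integrated G (S.erase i)).card ≤ 1 := by
  obtain ⟨v, huv, h⟩ := (mem_integrated G).1 hu
  have hne := huv.ne
  by_cases huS : u ∈ S
  · have hv : v ∉ S := by tauto
    refine (Finset.card_le_card (t := {u}) fun i hi => ?_).trans (Finset.card_singleton u).le
    rw [Finset.mem_filter, mem_integrated] at hi
    rw [Finset.mem_singleton]
    by_contra hiu
    exact hi.2 ⟨v, huv, by simp [huS, hv, Ne.symm hiu]⟩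
  · have hv : v ∈ S := by tauto
    refine (Finset.card_le_card (t := {v}) fun i hi => ?_).trans (Finset.card_singleton v).le
    rw [Finset.mem_filter, mem_integrated] at hi
    rw [Finset.mem_singleton]
    by_contra hiv
    exact hi.2 ⟨v, huv, by simp [huS, hv, Ne.symm hiv]⟩

/-- Double counting of the pairs (removed vertex, integrated vertex lost by it): there are at most
f(S) of them. -/
lemma card_mul_index_le_sum_erase (S : Finset (Fin n)) :
    S.card * index G S ≤ (∑ i ∈ S, index G (S.erase i)) + index G S := by
  have h1 : ∀ i ∈ S, index G S ≤ index G (S.erase i) +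
      ((integrated G S).filter fun u => u ∉ integrated G (S.erase i)).card := fun i _ => by
    rw [← Finset.sdiff_eq_filter]
    exact Finset.card_le_card_sdiff_add_card.trans (add_comm _ _).le
  have h2 : ∑ i ∈ S, ((integrated G S).filter fun u => u ∉ integrated G (S.erase i)).card ≤
      index G S := by
    calc _ = ∑ u ∈ integrated G S, (S.filter fun i => u ∉ integrated G (S.erase i)).card :=
          Finset.sum_card_bipartiteAbove_eq_sum_card_bipartiteBelow
            (fun i u => u ∉ integrated G (S.erase i))
      _ ≤ ∑ _u ∈ integrated G S, 1 :=
          Finset.sum_le_sum fun u hu => card_loss_le_one G hu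
      _ = index G S := by simp [index]
  calc S.card * index G S = ∑ _i ∈ S, index G S := by simp
    _ ≤ _ := Finset.sum_le_sum h1
    _ ≤ _ := by rw [Finset.sum_add_distrib]; gcongr

variable {G}

lemma GreedyMove.card {S T : Finset (Fin n)} (h : GreedyMove G S T) : T.card + 1 = S.card := by
  obtain ⟨i, hi, rfl, -⟩ := h
  exact Finset.card_erase_add_one hi

lemma GreedyMove.index_mul_card_le {S T : Finset (Fin n)} (h : GreedyMove G S T) :
    index G S * T.card ≤ index G T * S.card := by
  have hcard := h.card
  obtain ⟨i, hi, rfl, hmax⟩ := h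
  have h1 := card_mul_index_le_sum_erase G S
  have h2 : ∑ j ∈ S, index G (S.erase j) ≤ S.card * index G (S.erase i) := by
    rw [← smul_eq_mul]
    refine Finset.sum_le_card_nsmul _ _ _ fun j hj => ?_
    have := hmax j hj
    omega
  rw [← hcard] at h1 h2 ⊢
  nlinarith

/-- The quotient f(S)/|S| never decreases along greedy moves. -/
lemma index_mul_card_le_of_reflTransGen {S T : Finset (Fin n)}
    (h : Relation.ReflTransGen (GreedyMove G) S T) :
    index G S * T.card ≤ index G T * S.card := by
  induction h with
  | refl => exact le_rfl
  | @tail T U _ hTU ih =>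
    have h1 := hTU.index_mul_card_le
    have h2 := hTU.card
    -- The cancelled factor is positive, since T has one vertex more than U.
    refine Nat.le_of_mul_le_mul_right (c := T.card) ?_ (by omega)
    calc index G S * U.card * T.card = (index G S * T.card) * U.card := by ring
      _ ≤ (index G T * S.card) * U.card := by gcongr
      _ = (index G T * U.card) * S.card := by ring
      _ ≤ (index G U * T.card) * S.card := by gcongr
      _ = _ := by ring

lemma exists_greedyMove {S : Finset (Fin n)} (hS : S.Nonempty) : ∃ T, GreedyMove G S T := by
  obtain ⟨i, hi, hmax⟩ := S.exists_max_image (fun i => index G (S.erase i)) hS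
  refine ⟨S.erase i, i, hi, rfl, fun j hj => ?_⟩
  have := hmax j hj
  omega

lemma exists_reflTransGen_card {k : ℕ} {S : Finset (Fin n)} (hS : k ≤ S.card) :
    ∃ T, Relation.ReflTransGen (GreedyMove G) S T ∧ T.card = k := by
  induction hS using Nat.decreasingInduction with
  | self => exact ⟨S, .refl, rfl⟩
  | of_succ m _ ih =>
    obtain ⟨T, hST, hT⟩ := ih
    obtain ⟨U, hTU⟩ := exists_greedyMove (G := G) (S := T) (Finset.card_pos.1 (by omega))
    exact ⟨U, hST.tail hTU, by have := hTU.card; omega⟩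

variable (G)

lemma index_le_opt {k : ℕ} {T : Finset (Fin n)} (hT : T.card = k) : index G T ≤ opt G k :=
  Finset.le_sup (f := index G) (Finset.mem_powersetCard_univ.2 hT)

/-- The size of the side that size fixing shrinks. -/
def shrinkCard (k : ℕ) (S : Finset (Fin n)) : ℕ := if k ≤ S.card then S.card else n - S.card

variable {G}

lemma FixSize.index_mul_le {k : ℕ} (hk : 2 * k ≤ n) {S T : Finset (Fin n)}
    (h : FixSize G k S T) : index G S * k ≤ index G T * shrinkCard k S := by
  obtain ⟨hT, ⟨hS, h⟩ | ⟨hS, h | h⟩⟩ := h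
  · rw [shrinkCard, if_pos hS, ← hT]
    exact index_mul_card_le_of_reflTransGen h
  · have := index_mul_card_le_of_reflTransGen h
    rw [index_compl, hT, Finset.card_compl, Fintype.card_fin] at this
    rwa [shrinkCard, if_neg (by omega)]
  · have := index_mul_card_le_of_reflTransGen h
    rw [index_compl, index_compl, Finset.card_compl, Finset.card_compl, hT,
      Fintype.card_fin] at this
    rw [shrinkCard, if_neg (by omega)]
    -- Here n - k vertices remain on the shrunk side, and n - k ≥ k makes the bound only stronger.
    refine le_trans ?_ this
    gcongr
    omega

lemma exists_fixSize {k : ℕ} (hk : 2 * k ≤ n) (S : Finset (Fin n)) : ∃ T, FixSize G k S T := by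
  rcases le_or_gt k S.card with h | h
  · obtain ⟨T, h1, h2⟩ := exists_reflTransGen_card (G := G) h
    exact ⟨T, h2, .inl ⟨h, h1⟩⟩
  · obtain ⟨T, h1, h2⟩ := exists_reflTransGen_card (G := G) (k := k) (S := Sᶜ)
      (by rw [Finset.card_compl, Fintype.card_fin]; omega)
    exact ⟨T, h2, .inr ⟨h, .inl h1⟩⟩

/-- Some size-fixed set always exists and its index is at most OPT. This bounds the index of a
rounded set, whose size is arbitrary, in terms of OPT. -/
lemma index_mul_le_opt_mul {k : ℕ} (hk : 2 * k ≤ n) (S : Finset (Fin n)) :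
    index G S * k ≤ opt G k * shrinkCard k S := by
  obtain ⟨T, hT⟩ := exists_fixSize (G := G) hk S
  exact (hT.index_mul_le hk).trans (Nat.mul_le_mul_right _ (index_le_opt G hT.1))

lemma shrinkCard_le (k : ℕ) (S : Finset (Fin n)) : shrinkCard k S ≤ n := by
  unfold shrinkCard
  have : S.card ≤ n := by simpa using S.card_le_univ
  split_ifs <;> omega

lemma shrinkCard_mul_sub (k : ℕ) (S : Finset (Fin n)) :
    shrinkCard k S * (n - shrinkCard k S) = S.card * (Sᶜ).card := by
  rw [Finset.card_compl, Fintype.card_fin]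
  unfold shrinkCard
  have : S.card ≤ n := by simpa using S.card_le_univ
  split_ifs
  · rfl
  · rw [Nat.sub_sub_self this, mul_comm]

end Greedy

/-! ### The relaxation bounds the optimum -/

lemma sum_sum_eq_diag_add_two_mul {n : ℕ} {f : Fin n → Fin n → ℝ} (hf : ∀ i j, f i j = f j i) :
    ∑ i, ∑ j, f i j = ∑ i, f i i + 2 * ∑ i, ∑ j ∈ Finset.Ioi i, f i j := by
  have h1 : ∀ i, ∑ j, f i j = f i i + ∑ j ∈ Finset.Ioi i, f i j + ∑ j ∈ Finset.Iio i, f i j := by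
    intro i
    have : (Finset.univ : Finset (Fin n)) = insert i (Finset.Ioi i ∪ Finset.Iio i) := by
      ext j
      simp only [Finset.mem_univ, Finset.mem_insert, Finset.mem_union, Finset.mem_Ioi,
        Finset.mem_Iio, true_iff]
      have := lt_trichotomy i j
      tauto
    rw [this, Finset.sum_insert (by simp), Finset.sum_union, add_assoc]
    rw [Finset.disjoint_left]
    intro j hj hj'
    simp only [Finset.mem_Ioi, Finset.mem_Iio] at hj hj'
    exact lt_asymm hj hj'
  have h2 : ∑ i, ∑ j ∈ Finset.Iio i, f i j = ∑ i, ∑ j ∈ Finset.Ioi i, f i j := by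
    rw [Finset.sum_comm' (t' := Finset.univ) (s' := fun j => Finset.Ioi j) (by simp)]
    simp_rw [hf]
  simp_rw [h1]
  rw [Finset.sum_add_distrib, Finset.sum_add_distrib, h2]
  ring

lemma index_le_sdpObjective_of_sign {n : ℕ} (G : SimpleGraph (Fin n)) (S : Finset (Fin n))
    {e : EuclideanSpace ℝ (Fin n)} (he : ‖e‖ = 1) :
    (index G S : ℝ) ≤ sdpObjective G fun i => (if i ∈ S then (1 : ℝ) else -1) • e := by
  have hinner : ∀ a b : ℝ, inner ℝ (a • e) (b • e) = a * b := fun a b => by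
    rw [real_inner_smul_left, real_inner_smul_right, real_inner_self_eq_norm_sq, he]; ring
  have hsum : (index G S : ℝ) = ∑ i, if i ∈ integrated G S then (1 : ℝ) else 0 := by
    simp [index]
  rw [hsum, sdpObjective]
  simp_rw [hinner]
  refine Finset.sum_le_sum fun i _ => ?_
  split_ifs with hi hiS hiS
  · obtain ⟨j, hij, h⟩ := (mem_integrated G).1 hi
    refine le_ciSup_of_le (Set.finite_range _).bddAbove ⟨j, hij⟩ ?_
    simp [show j ∉ S by tauto]
  · obtain ⟨j, hij, h⟩ := (mem_integrated G).1 hi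
    refine le_ciSup_of_le (Set.finite_range _).bddAbove ⟨j, hij⟩ ?_
    simp [show j ∈ S by tauto]
  · refine Real.iSup_nonneg fun j => ?_
    split_ifs <;> norm_num
  · refine Real.iSup_nonneg fun j => ?_
    split_ifs <;> norm_num

/-- The square of the sum of the signs is (2k - n)² = (1-2α)²n², so the constraint holds with
equality. -/
lemma sdpFeasible_sign {n k : ℕ} (hn : n ≠ 0) {S : Finset (Fin n)} (hS : S.card = k)
    {e : EuclideanSpace ℝ (Fin n)} (he : ‖e‖ = 1) :
    SDPFeasible ((k : ℝ) / n) fun i => (if i ∈ S then (1 : ℝ) else -1) • e := by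
  have hinner : ∀ a b : ℝ, inner ℝ (a • e) (b • e) = a * b := fun a b => by
    rw [real_inner_smul_left, real_inner_smul_right, real_inner_self_eq_norm_sq, he]; ring
  set σ : Fin n → ℝ := fun i => if i ∈ S then (1 : ℝ) else -1
  have hσ : ∀ i, σ i * σ i = 1 := fun i => by simp only [σ]; split_ifs <;> norm_num
  refine ⟨fun i => by rw [hinner]; exact hσ i, ?_⟩
  simp_rw [hinner]
  have h1 := sum_sum_eq_diag_add_two_mul (f := fun i j => σ i * σ j) fun i j => mul_comm _ _
  have h2 : ∑ i, σ i = 2 * k - n := by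
    have : ∀ i, σ i = 2 * (if i ∈ S then (1 : ℝ) else 0) - 1 := fun i => by
      simp only [σ]; split_ifs <;> norm_num
    simp_rw [this]
    rw [Finset.sum_sub_distrib, ← Finset.mul_sum]
    simp [hS]
  simp_rw [hσ, ← Finset.mul_sum, ← Finset.sum_mul, h2] at h1
  simp only [Finset.sum_const, Finset.card_univ, Fintype.card_fin, nsmul_eq_mul, mul_one] at h1
  simp_rw [← Finset.mul_sum]
  have hn' : (n : ℝ) ≠ 0 := by exact_mod_cast hn
  have h3 : (1 - 2 * ((k : ℝ) / n)) ^ 2 * (n : ℝ) ^ 2 = (2 * k - n) * (2 * k - n) := by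
    field_simp; ring
  rw [h3]
  change ∑ i, σ i * ∑ j ∈ Finset.Ioi i, σ j ≤ _
  linarith

lemma SDPFeasible.norm_eq_one {n : ℕ} {α : ℝ} {y : Fin n → EuclideanSpace ℝ (Fin n)}
    (hy : SDPFeasible α y) (i : Fin n) : ‖y i‖ = 1 := by
  have := hy.1 i
  rw [real_inner_self_eq_norm_sq] at this
  exact (pow_eq_one_iff_of_nonneg (norm_nonneg _) two_ne_zero).1 this

lemma SDPOptimal.opt_le {n k : ℕ} {G : SimpleGraph (Fin n)} (hn : n ≠ 0)
    {y : Fin n → EuclideanSpace ℝ (Fin n)} (hy : SDPOptimal G ((k : ℝ) / n) y) :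
    (opt G k : ℝ) ≤ sdpObjective G y := by
  have hpos : ∀ i, 0 ≤ ⨆ j : {j : Fin n // G.Adj i j}, (1 - inner ℝ (y i) (y j)) / 2 := by
    intro i
    refine Real.iSup_nonneg fun j => ?_
    have h := real_inner_le_norm (y i) (y j)
    rw [hy.1.norm_eq_one, hy.1.norm_eq_one] at h
    linarith
  rcases (Finset.univ.powersetCard k : Finset (Finset (Fin n))).eq_empty_or_nonempty with h | h
  · rw [opt, h, Finset.sup_empty, Nat.bot_eq_zero, Nat.cast_zero]
    exact Finset.sum_nonneg fun i _ => hpos i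
  · obtain ⟨S, hS, hmax⟩ := Finset.exists_mem_eq_sup _ h (index G)
    rw [opt, hmax]
    let e : EuclideanSpace ℝ (Fin n) := EuclideanSpace.single ⟨0, by omega⟩ 1
    have he : ‖e‖ = 1 := by simp [e]
    exact (index_le_sdpObjective_of_sign G S he).trans
      (hy.2 _ (sdpFeasible_sign hn (Finset.mem_powersetCard_univ.1 hS) he))

/-! ### Expectations of the rounded partition -/

section Rounding

variable {n : ℕ} {y : Fin n → EuclideanSpace ℝ (Fin n)}

lemma mem_hyperplaneRound {r : EuclideanSpace ℝ (Fin n)} {i : Fin n} :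
    i ∈ hyperplaneRound y r ↔ 0 ≤ (inner ℝ (y i) r : ℝ) := by
  simp [hyperplaneRound]

lemma measurableSet_hyperplaneRound (y : Fin n → EuclideanSpace ℝ (Fin n))
    (p : Finset (Fin n) → Prop) : MeasurableSet {r | p (hyperplaneRound y r)} := by
  have h : {r | p (hyperplaneRound y r)} = ⋃ S ∈ {S | p S}, ⋂ i,
      {r | 0 ≤ (inner ℝ (y i) r : ℝ) ↔ i ∈ S} := by
    ext r
    simp only [Set.mem_ofPred_eq, Set.mem_iUnion, Set.mem_iInter, exists_prop]
    constructor
    · exact fun hp => ⟨_, hp, fun i => mem_hyperplaneRound.symm⟩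
    · rintro ⟨S, hS, h⟩
      have : hyperplaneRound y r = S := by
        ext i
        rw [mem_hyperplaneRound, h i]
      rwa [this]
  rw [h]
  refine MeasurableSet.biUnion (Set.to_countable _) fun S _ => MeasurableSet.iInter fun i => ?_
  have hm : MeasurableSet {r | 0 ≤ (inner ℝ (y i) r : ℝ)} :=
    measurableSet_le (by fun_prop) (by fun_prop)
  by_cases hi : i ∈ S
  · simpa [hi] using hm
  · have := hm.compl
    rw [Set.compl_ofPred] at this
    simpa [hi] using this

lemma integrable_comp_hyperplaneRound (y : Fin n → EuclideanSpace ℝ (Fin n))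
    (F : Finset (Fin n) → ℝ) :
    Integrable (fun r => F (hyperplaneRound y r)) (stdGaussian (EuclideanSpace ℝ (Fin n))) := by
  refine Integrable.of_bound (C := ∑ S, |F S|) (Measurable.aestronglyMeasurable ?_)
    (.of_forall fun r => ?_)
  · intro s _
    exact measurableSet_hyperplaneRound y fun S => F S ∈ s
  · exact Finset.single_le_sum (f := fun S => |F S|) (fun S _ => abs_nonneg _)
      (Finset.mem_univ _)

lemma integral_ite_hyperplaneRound (y : Fin n → EuclideanSpace ℝ (Fin n))
    (p : Finset (Fin n) → Prop) [DecidablePred p] :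
    ∫ r, (if p (hyperplaneRound y r) then (1 : ℝ) else 0)
        ∂(stdGaussian (EuclideanSpace ℝ (Fin n))) =
      (stdGaussian (EuclideanSpace ℝ (Fin n))).real {r | p (hyperplaneRound y r)} := by
  rw [← integral_indicator_one (measurableSet_hyperplaneRound y p)]
  refine integral_congr_ae (.of_forall fun r => ?_)
  by_cases h : p (hyperplaneRound y r) <;> simp [Set.indicator, h]

lemma gwConst_mul_le_separation (hn : 2 ≤ n) (hy : ∀ i, ‖y i‖ = 1) (i j : Fin n) :
    gwConst * (1 - inner ℝ (y i) (y j)) / 4 ≤ (stdGaussian (EuclideanSpace ℝ (Fin n))).real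
      {r | i ∈ hyperplaneRound y r ∧ j ∉ hyperplaneRound y r} := by
  have h := arccos_le_stdGaussian_wedge (E := EuclideanSpace ℝ (Fin n)) (by simpa using hn)
    (hy i) (hy j)
  have habs : |inner ℝ (y i) (y j)| ≤ (1 : ℝ) := by
    simpa [hy] using abs_real_inner_le_norm (y i) (y j)
  have h2 := gwConst_mul_le (abs_le.1 habs)
  simp only [mem_hyperplaneRound, not_le]
  refine le_trans ?_ h
  have h3 : Real.arccos (inner ℝ (y i) (y j)) / (2 * Real.pi) =
      Real.arccos (inner ℝ (y i) (y j)) / Real.pi / 2 := by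
    field_simp
  rw [h3]
  linarith

/-- Separation from the single neighbour attaining the maximum already integrates i. The two orders
of separation are disjoint events, each contributing half of the bound. -/
lemma gwConst_mul_iSup_le (G : SimpleGraph (Fin n)) (hn : 2 ≤ n) (hy : ∀ i, ‖y i‖ = 1)
    (i : Fin n) :
    gwConst * (⨆ j : {j : Fin n // G.Adj i j}, (1 - inner ℝ (y i) (y j)) / 2) ≤
      (stdGaussian (EuclideanSpace ℝ (Fin n))).real
        {r | i ∈ integrated G (hyperplaneRound y r)} := by
  rcases isEmpty_or_nonempty {j : Fin n // G.Adj i j} with h | h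
  · simp
  · obtain ⟨⟨j, hij⟩, hj⟩ := exists_eq_ciSup_of_finite
      (f := fun j : {j : Fin n // G.Adj i j} => (1 - inner ℝ (y i) (y j)) / 2)
    rw [← hj]
    have h1 := gwConst_mul_le_separation hn hy i j
    have h2 := gwConst_mul_le_separation hn hy j i
    have hdisj : Disjoint {r | i ∈ hyperplaneRound y r ∧ j ∉ hyperplaneRound y r}
        {r | j ∈ hyperplaneRound y r ∧ i ∉ hyperplaneRound y r} := by
      rw [Set.disjoint_left]
      rintro r ⟨hr, -⟩ ⟨-, hr'⟩
      exact hr' hr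
    have h3 := measureReal_union (μ := stdGaussian (EuclideanSpace ℝ (Fin n))) hdisj
      (measurableSet_hyperplaneRound y fun S => j ∈ S ∧ i ∉ S)
    have h4 : (stdGaussian (EuclideanSpace ℝ (Fin n))).real
        ({r | i ∈ hyperplaneRound y r ∧ j ∉ hyperplaneRound y r} ∪
          {r | j ∈ hyperplaneRound y r ∧ i ∉ hyperplaneRound y r}) ≤
        (stdGaussian (EuclideanSpace ℝ (Fin n))).real
          {r | i ∈ integrated G (hyperplaneRound y r)} := by
      refine measureReal_mono ?_
      rintro r (⟨h1, h2⟩ | ⟨h1, h2⟩)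
      · exact (mem_integrated G).2 ⟨j, hij, by tauto⟩
      · exact (mem_integrated G).2 ⟨j, hij, by tauto⟩
    rw [real_inner_comm] at h2
    dsimp only
    linarith

open Classical in
lemma gwConst_mul_sdpObjective_le (G : SimpleGraph (Fin n)) (hn : 2 ≤ n)
    (hy : ∀ i, ‖y i‖ = 1) :
    gwConst * sdpObjective G y ≤ ∫ r, (index G (hyperplaneRound y r) : ℝ)
      ∂(stdGaussian (EuclideanSpace ℝ (Fin n))) := by
  have hsum : ∀ S, (index G S : ℝ) = ∑ i, if i ∈ integrated G S then (1 : ℝ) else 0 := fun S => by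
    simp [index]
  simp_rw [hsum]
  rw [integral_finsetSum _ fun i _ => integrable_comp_hyperplaneRound y
    fun S => if i ∈ integrated G S then (1 : ℝ) else 0, sdpObjective, Finset.mul_sum]
  refine Finset.sum_le_sum fun i _ => ?_
  rw [integral_ite_hyperplaneRound y fun S => i ∈ integrated G S]
  exact gwConst_mul_iSup_le G hn hy i

open Classical in
lemma card_mul_card_compl_eq_sum (S : Finset (Fin n)) :
    (S.card : ℝ) * (Sᶜ).card = ∑ i, ∑ j, if i ∈ S ∧ j ∉ S then (1 : ℝ) else 0 := by
  have h1 : (S.card : ℝ) = ∑ i, if i ∈ S then (1 : ℝ) else 0 := by simp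
  have h2 : ((Sᶜ).card : ℝ) = ∑ j, if j ∉ S then (1 : ℝ) else 0 := by
    rw [← Finset.sum_filter, Finset.sum_const, nsmul_eq_mul, mul_one]
    congr 2
    ext j
    simp
  rw [h1, h2, Finset.sum_mul_sum]
  refine Finset.sum_congr rfl fun i _ => Finset.sum_congr rfl fun j _ => ?_
  by_cases hi : i ∈ S <;> by_cases hj : j ∈ S <;> simp [hi, hj]

open Classical in
lemma SDPFeasible.gwConst_mul_le_integral_card {α : ℝ} (hn : 2 ≤ n) (hy : SDPFeasible α y) :
    gwConst * (α * (1 - α)) * n ^ 2 ≤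
      ∫ r, ((hyperplaneRound y r).card : ℝ) * ((hyperplaneRound y r)ᶜ).card
        ∂(stdGaussian (EuclideanSpace ℝ (Fin n))) := by
  simp_rw [card_mul_card_compl_eq_sum]
  rw [integral_finsetSum _ fun i _ => integrable_comp_hyperplaneRound y
    fun S => ∑ j, if i ∈ S ∧ j ∉ S then (1 : ℝ) else 0]
  have h1 : ∀ i : Fin n, ∑ j, gwConst * (1 - inner ℝ (y i) (y j)) / 4 ≤
      ∫ r, ∑ j, (if i ∈ hyperplaneRound y r ∧ j ∉ hyperplaneRound y r then (1 : ℝ) else 0)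
        ∂(stdGaussian (EuclideanSpace ℝ (Fin n))) := by
    intro i
    rw [integral_finsetSum _ fun j _ => integrable_comp_hyperplaneRound y
      fun S => if i ∈ S ∧ j ∉ S then (1 : ℝ) else 0]
    refine Finset.sum_le_sum fun j _ => ?_
    rw [integral_ite_hyperplaneRound y fun S => i ∈ S ∧ j ∉ S]
    exact gwConst_mul_le_separation hn hy.norm_eq_one i j
  refine le_trans ?_ (Finset.sum_le_sum fun i _ => h1 i)
  have h2 := sum_sum_eq_diag_add_two_mul (f := fun i j => (inner ℝ (y i) (y j) : ℝ))
    fun i j => real_inner_comm _ _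
  have h3 := hy.2
  simp_rw [hy.1] at h2
  simp only [Finset.sum_const, Finset.card_univ, Fintype.card_fin, nsmul_eq_mul, mul_one] at h2
  have h4 : ∑ i, ∑ j, gwConst * (1 - inner ℝ (y i) (y j)) / 4 =
      gwConst / 4 * ((n : ℝ) ^ 2 - ∑ i, ∑ j, inner ℝ (y i) (y j)) := by
    simp_rw [mul_div_right_comm, mul_sub, Finset.sum_sub_distrib, ← Finset.mul_sum]
    simp only [Finset.sum_const, Finset.card_univ, Fintype.card_fin, nsmul_eq_mul, mul_one]
    ring
  rw [h4]
  have hg := gwConst_ge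
  -- The diagonal contributes n and the constraint bounds twice the rest, so the double sum is at
  -- most (1-2α)²n².
  have h5 : 4 * (α * (1 - α)) * n ^ 2 ≤ (n : ℝ) ^ 2 - ∑ i, ∑ j, inner ℝ (y i) (y j) := by
    rw [h2]; linarith
  calc gwConst * (α * (1 - α)) * n ^ 2 = gwConst / 4 * (4 * (α * (1 - α)) * n ^ 2) := by ring
    _ ≤ _ := by gcongr

end Rounding

/-! ### The success probability of one round -/

section Success

variable {n : ℕ}

/-- A rounded set from which size fixing is guaranteed to reach the ratio. -/
def GoodSet (G : SimpleGraph (Fin n)) (k : ℕ) (α ε : ℝ) (S : Finset (Fin n)) : Prop :=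
  (2 * gammaConst α ε - 1) * shrinkCard k S * opt G k ≤ α * (1 - α) * index G S * n

lemma le_index_of_goodSet {G : SimpleGraph (Fin n)} {k : ℕ} (hk0 : 0 < k) (hk : 2 * k ≤ n)
    {ε : ℝ} {S T : Finset (Fin n)} (hS : GoodSet G k ((k : ℝ) / n) ε S) (hT : FixSize G k S T) :
    (2 * gammaConst ((k : ℝ) / n) ε - 1) / (1 - (k : ℝ) / n) * opt G k ≤ index G T := by
  have hn : (0 : ℝ) < n := by exact_mod_cast (by omega : 0 < n)
  have hk' : (0 : ℝ) < k := by exact_mod_cast hk0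
  have hkn : 2 * (k : ℝ) ≤ n := by exact_mod_cast hk
  have hd : (0 : ℝ) < shrinkCard k S := by
    have : 0 < shrinkCard k S := by unfold shrinkCard; split_ifs <;> omega
    exact_mod_cast this
  have h : (index G S : ℝ) * k ≤ index G T * shrinkCard k S := by
    exact_mod_cast hT.index_mul_le hk
  set α : ℝ := (k : ℝ) / n
  have hα : α * n = k := by simp only [α]; field_simp
  have hα1 : 0 < 1 - α := by
    have : α ≤ 1 / 2 := by simp only [α]; rw [div_le_div_iff₀ hn (by norm_num)]; linarith
    linarith
  rw [div_mul_eq_mul_div, div_le_iff₀ hα1]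
  refine le_of_mul_le_mul_right ?_ hd
  unfold GoodSet at hS
  calc (2 * gammaConst α ε - 1) * opt G k * shrinkCard k S
      = (2 * gammaConst α ε - 1) * shrinkCard k S * opt G k := by ring
    _ ≤ α * (1 - α) * index G S * n := hS
    _ = (index G S * (α * n)) * (1 - α) := by ring
    _ = (index G S * k) * (1 - α) := by rw [hα]
    _ ≤ (index G T * shrinkCard k S) * (1 - α) := by gcongr
    _ = _ := by ring

/-- The numerical gap between the mean of the weight and its bound on bad sets; it closes shortly
below x = 2/3, hence the hypothesis on x². -/
lemma quadratic_margin {x : ℝ} (h0 : 1 / 2 ≤ x) (h1 : x ^ 2 ≤ 0.44) :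
    (2 * x - 0.01) ^ 2 / 3.96 + 0.00002 ≤ x ^ 2 * 1.99 / 2 := by
  have h2 : x ≤ 0.6634 := by
    by_contra! h
    nlinarith
  have h3 : 0 ≤ (x - 1 / 2) * (0.6634 - x) := mul_nonneg (by linarith) (by linarith)
  ring_nf at h3 ⊢
  linarith

/-- Completing the square in d; the maximum is at d = (2c - 0.01)/1.98. -/
lemma linear_add_quadratic_le {c d x : ℝ} (hc : 1 / 2 ≤ c) (hcx : c ≤ x) :
    (2 * c - 1) * d + 0.99 * (d * (1 - d)) ≤ (2 * x - 0.01) ^ 2 / 3.96 := by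
  have h1 : (2 * c - 0.01) ^ 2 ≤ (2 * x - 0.01) ^ 2 := by
    apply pow_le_pow_left₀ <;> linarith
  have h2 := sq_nonneg ((2 * c - 0.01) - 1.98 * d)
  ring_nf at h1 h2 ⊢
  linarith

lemma gammaConst_le_of_nonneg {α ε : ℝ} (h0 : 0 ≤ α) (h1 : α ≤ 1) (hε : 0 ≤ ε) :
    gammaConst α ε ≤ gammaConst α 0 := by
  have := gwConst_ge
  have h2 : 0 ≤ 1 - α := by linarith
  unfold gammaConst
  gcongr

/-- The linear combination of index and balance whose expectation drives the analysis. -/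
noncomputable def weight (G : SimpleGraph (Fin n)) (k : ℕ) (α : ℝ) (S : Finset (Fin n)) : ℝ :=
  α * (1 - α) / opt G k * index G S + 0.99 / n ^ 2 * ((S.card : ℝ) * (Sᶜ).card)

lemma le_integral_weight {G : SimpleGraph (Fin n)} {k : ℕ} (hn : 2 ≤ n) {α : ℝ}
    (hα : α = (k : ℝ) / n) (h0 : 0 < α) (h1 : α ≤ 1 / 2) (hopt : 0 < opt G k)
    {y : Fin n → EuclideanSpace ℝ (Fin n)} (hy : SDPOptimal G α y) :
    gammaConst α 0 ^ 2 * 1.99 / 2 ≤ ∫ r, weight G k α (hyperplaneRound y r)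
      ∂(stdGaussian (EuclideanSpace ℝ (Fin n))) := by
  have hn' : (0 : ℝ) < n := by exact_mod_cast (by omega : 0 < n)
  have hopt' : (0 : ℝ) < opt G k := by exact_mod_cast hopt
  have hg := gwConst_ge
  have hα1 : 0 ≤ 1 - α := by linarith
  rw [gammaConst_sq h0.le (by linarith) zero_le_one]
  unfold weight
  rw [integral_add ((integrable_comp_hyperplaneRound y fun S => (index G S : ℝ)).const_mul _)
    ((integrable_comp_hyperplaneRound y fun S => (S.card : ℝ) * (Sᶜ).card).const_mul _),
    integral_const_mul, integral_const_mul]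
  have e1 : gwConst * opt G k ≤ ∫ r, (index G (hyperplaneRound y r) : ℝ)
      ∂(stdGaussian (EuclideanSpace ℝ (Fin n))) := by
    refine le_trans ?_ (gwConst_mul_sdpObjective_le G hn hy.1.norm_eq_one)
    have : (opt G k : ℝ) ≤ sdpObjective G y := SDPOptimal.opt_le (by omega) (hα ▸ hy)
    gcongr
  have e2 := hy.1.gwConst_mul_le_integral_card hn
  calc α * (1 - α) * (1 - 0) * (2 * gwConst) * 1.99 / 2
      = α * (1 - α) / opt G k * (gwConst * opt G k) +
        0.99 / n ^ 2 * (gwConst * (α * (1 - α)) * n ^ 2) := by field_simp; ring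
    _ ≤ _ := by gcongr

-- Both the balance term and the definition of a good set depend on the rounded set's size only
-- through δ, so bad sets reduce to a quadratic in δ. On good sets a crude bound by 2 suffices, one
-- for each term of the weight.
open Classical in
lemma weight_le {G : SimpleGraph (Fin n)} {k : ℕ} (hk0 : 0 < k) (hk : 2 * k ≤ n) {α ε : ℝ}
    (hα : α = (k : ℝ) / n) (hopt : 0 < opt G k) (hε : 0 ≤ ε) (hγ : 1 / 2 ≤ gammaConst α ε)
    (S : Finset (Fin n)) :
    weight G k α S ≤ (2 * gammaConst α 0 - 0.01) ^ 2 / 3.96 +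
      2 * if GoodSet G k α ε S then 1 else 0 := by
  have hn : (0 : ℝ) < n := by exact_mod_cast (by omega : 0 < n)
  have hk' : (0 : ℝ) < k := by exact_mod_cast hk0
  have hkn : 2 * (k : ℝ) ≤ n := by exact_mod_cast hk
  have hopt' : (0 : ℝ) < opt G k := by exact_mod_cast hopt
  have h0 : 0 < α := by rw [hα]; positivity
  have h1 : α ≤ 1 / 2 := by rw [hα, div_le_div_iff₀ hn (by norm_num)]; linarith
  have hαn : α * n = k := by rw [hα]; field_simp
  have hdn := shrinkCard_le k S
  have hbal : (S.card : ℝ) * (Sᶜ).card = shrinkCard k S * (n - shrinkCard k S) := by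
    rw [← Nat.cast_sub hdn]
    exact_mod_cast (shrinkCard_mul_sub k S).symm
  have hX : (index G S : ℝ) * k ≤ opt G k * shrinkCard k S := by
    exact_mod_cast index_mul_le_opt_mul hk S
  have hdn' : (shrinkCard k S : ℝ) ≤ n := by exact_mod_cast hdn
  rw [weight, hbal]
  obtain ⟨δ, hδ⟩ : ∃ δ : ℝ, (shrinkCard k S : ℝ) = δ * n :=
    ⟨shrinkCard k S / n, by field_simp⟩
  have hδ0 : 0 ≤ δ := by
    have : (0 : ℝ) ≤ δ * n := hδ ▸ Nat.cast_nonneg _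
    exact nonneg_of_mul_nonneg_left this hn
  have hδ1 : δ ≤ 1 := by
    rw [hδ] at hdn'
    exact le_of_mul_le_mul_right (by linarith) hn
  have hb : 0.99 / (n : ℝ) ^ 2 * (shrinkCard k S * (n - shrinkCard k S)) =
      0.99 * (δ * (1 - δ)) := by
    rw [hδ]; field_simp
  rw [hb]
  split_ifs with hgood
  · have h2 : α * (1 - α) / opt G k * index G S ≤ (1 - α) * δ := by
      rw [div_mul_eq_mul_div, div_le_iff₀ hopt']
      refine le_of_mul_le_mul_right ?_ hn
      have h1α : 0 ≤ 1 - α := by linarith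
      calc α * (1 - α) * index G S * n = (1 - α) * (index G S * (α * n)) := by ring
        _ ≤ (1 - α) * (opt G k * (δ * n)) := by rw [hαn, ← hδ]; gcongr
        _ = _ := by ring
    have h3 : (1 - α) * δ ≤ 1 := by nlinarith
    have h4 : δ * (1 - δ) ≤ 1 := by nlinarith
    have h5 : 0 ≤ (2 * gammaConst α 0 - 0.01) ^ 2 / 3.96 := by positivity
    linarith
  · have h2 : α * (1 - α) / opt G k * index G S ≤ (2 * gammaConst α ε - 1) * δ := by
      rw [GoodSet, not_le, hδ] at hgood
      rw [div_mul_eq_mul_div, div_le_iff₀ hopt']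
      refine le_of_mul_le_mul_right ?_ hn
      linarith
    have h3 := linear_add_quadratic_le (d := δ) hγ
      (gammaConst_le_of_nonneg h0.le (by linarith) hε)
    linarith

lemma le_measureReal_goodSet {G : SimpleGraph (Fin n)} {k : ℕ} (hk0 : 0 < k) (hk : 2 * k ≤ n)
    {α ε : ℝ} (hα : α = (k : ℝ) / n) (hε : 0 ≤ ε)
    {y : Fin n → EuclideanSpace ℝ (Fin n)} (hy : SDPOptimal G α y) :
    0.00001 ≤ (stdGaussian (EuclideanSpace ℝ (Fin n))).real
      {r | GoodSet G k α ε (hyperplaneRound y r)} := by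
  classical
  have hn : (0 : ℝ) < n := by exact_mod_cast (by omega : 0 < n)
  have hk' : (0 : ℝ) < k := by exact_mod_cast hk0
  have hkn : 2 * (k : ℝ) ≤ n := by exact_mod_cast hk
  have h0 : 0 < α := by rw [hα]; positivity
  have h1 : α ≤ 1 / 2 := by rw [hα, div_le_div_iff₀ hn (by norm_num)]; linarith
  have h1α : 0 ≤ 1 - α := by linarith
  -- In these cases the left side of `GoodSet` is at most 0 and every set is good.
  by_cases htriv : opt G k = 0 ∨ gammaConst α ε < 1 / 2
  · have hall : {r | GoodSet G k α ε (hyperplaneRound y r)} = Set.univ := by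
      refine Set.eq_univ_of_forall fun r => ?_
      have hr : 0 ≤ α * (1 - α) * index G (hyperplaneRound y r) * n := by positivity
      refine le_trans ?_ hr
      rcases htriv with h | h
      · simp [h]
      · rw [mul_assoc]
        exact mul_nonpos_of_nonpos_of_nonneg (by linarith) (by positivity)
    rw [hall, probReal_univ]
    norm_num
  · push Not at htriv
    obtain ⟨hopt, hγ⟩ := htriv
    have hw := le_integral_weight (by omega) hα h0 h1 (Nat.pos_of_ne_zero hopt) hy
    have hle : ∫ r, weight G k α (hyperplaneRound y r)
        ∂(stdGaussian (EuclideanSpace ℝ (Fin n))) ≤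
        ∫ r, ((2 * gammaConst α 0 - 0.01) ^ 2 / 3.96 +
          2 * if GoodSet G k α ε (hyperplaneRound y r) then (1 : ℝ) else 0)
          ∂(stdGaussian (EuclideanSpace ℝ (Fin n))) :=
      integral_mono (integrable_comp_hyperplaneRound y (weight G k α))
        (integrable_comp_hyperplaneRound y fun S => (2 * gammaConst α 0 - 0.01) ^ 2 / 3.96 +
          2 * if GoodSet G k α ε S then (1 : ℝ) else 0)
        fun r => weight_le hk0 hk hα (Nat.pos_of_ne_zero hopt) hε hγ _
    rw [integral_add (integrable_const _) ((integrable_comp_hyperplaneRound y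
      fun S => if GoodSet G k α ε S then (1 : ℝ) else 0).const_mul _), integral_const,
      integral_const_mul, integral_ite_hyperplaneRound y (GoodSet G k α ε), probReal_univ,
      one_smul] at hle
    have hsq : gammaConst α 0 ^ 2 ≤ 0.44 := by
      rw [gammaConst_sq h0.le (by linarith) zero_le_one]
      have h3 : α * (1 - α) ≤ 1 / 4 := by nlinarith [sq_nonneg (α - 1 / 2)]
      have h4 := gwConst_le
      have h5 := gwConst_ge
      nlinarith
    have hm := quadratic_margin
      (hγ.trans (gammaConst_le_of_nonneg h0.le (by linarith) hε)) hsq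
    linarith

end Success

/-! ### Amplification by independent rounds -/

lemma one_le_betaConst {α : ℝ} (h0 : 0 < α) (h1 : α < 1) : 1 ≤ betaConst α := by
  have h : 0 < α - α ^ 2 := by nlinarith
  rw [betaConst, le_div_iff₀ (by positivity)]
  nlinarith [sq_nonneg (α - 1 / 2)]

/-- The base is 1 + 2gε/(1+β-2g) with g = `gwConst`. Since β ≥ 1 and g ≤ 0.88, the denominator is at
least 0.24, so ε ≤ 10⁻⁶ keeps the excess over 1 below 10⁻⁵. -/
lemma logBase_bounds {α ε : ℝ} (h0 : 0 < α) (h1 : α < 1) (hε : 0 < ε) (hε' : ε ≤ 0.000001) :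
    1 < logBase α ε ∧ 0.99999 * logBase α ε ≤ 1 := by
  have hβ := one_le_betaConst h0 h1
  have hg := gwConst_ge
  have hg' := gwConst_le
  have hD : 0 < 1 + betaConst α - 2 * gwConst := by linarith
  have hgε : 0 < gwConst * ε := by positivity
  have hgε' : gwConst * ε ≤ 0.88 * 0.000001 := by gcongr
  rw [logBase]
  constructor
  · rw [lt_div_iff₀ hD]
    linarith
  · rw [mul_div_assoc', div_le_iff₀ hD]
    linarith

lemma pow_numRounds_le {α ε p : ℝ} (h0 : 0 < α) (h1 : α < 1) (hε : 0 < ε)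
    (hε' : ε ≤ 0.000001) (hp0 : 0 ≤ p) (hp : p ≤ 0.99999) : p ^ numRounds α ε ≤ ε := by
  obtain ⟨ha, ha'⟩ := logBase_bounds h0 h1 hε hε'
  set a := logBase α ε
  have ha0 : 0 < a := by linarith
  have h2 : 1 / ε ≤ a ^ numRounds α ε := by
    rw [← Real.rpow_natCast, ← Real.rpow_logb ha0 ha.ne' (by positivity : 0 < 1 / ε)]
    exact Real.rpow_le_rpow_of_exponent_le ha.le (Nat.le_ceil _)
  -- The failure probability of a round is at most 1/a, so the definition of L through log_a
  -- applies.
  have h3 : (p * a) ^ numRounds α ε ≤ 1 := by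
    refine pow_le_one₀ (by positivity) (le_trans ?_ ha')
    gcongr
  rw [mul_pow] at h3
  rw [div_le_iff₀ hε] at h2
  calc p ^ numRounds α ε = p ^ numRounds α ε * 1 := (mul_one _).symm
    _ ≤ p ^ numRounds α ε * (a ^ numRounds α ε * ε) := by gcongr
    _ = (p ^ numRounds α ε * a ^ numRounds α ε) * ε := by ring
    _ ≤ 1 * ε := by gcongr
    _ = ε := one_mul ε

lemma BestOfRounds.le_index {n k M : ℕ} {G : SimpleGraph (Fin n)} (hk0 : 0 < k)
    (hk : 2 * k ≤ n) {ε : ℝ} {y : Fin n → EuclideanSpace ℝ (Fin n)}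
    {r : Fin M → EuclideanSpace ℝ (Fin n)} {T : Finset (Fin n)}
    (hT : BestOfRounds G k y r T)
    (hgood : ∃ l, GoodSet G k ((k : ℝ) / n) ε (hyperplaneRound y (r l))) :
    (2 * gammaConst ((k : ℝ) / n) ε - 1) / (1 - (k : ℝ) / n) * opt G k ≤ index G T := by
  obtain ⟨R, hR, _, _, hmax⟩ := hT
  obtain ⟨l, hl⟩ := hgood
  refine (le_index_of_goodSet hk0 hk hl (hR l)).trans ?_
  exact_mod_cast hmax l

section Amplification

variable {Ω : Type*} [MeasurableSpace Ω] {P : Measure Ω}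

lemma measureReal_forall_not_eq {E : Type*} [NormedAddCommGroup E] [InnerProductSpace ℝ E]
    [FiniteDimensional ℝ E] [MeasurableSpace E] [BorelSpace E] {M : ℕ} {r : Fin M → Ω → E}
    (hlaw : ∀ l, HasLaw (r l) (stdGaussian E) P) (hind : iIndepFun r P) {p : E → Prop}
    (hp : MeasurableSet {v | p v}) :
    P.real {ω | ∀ l, ¬p (r l ω)} = (1 - (stdGaussian E).real {v | p v}) ^ M := by
  have h := hind.measure_inter_preimage_eq_mul Finset.univ (sets := fun _ => {v | p v}ᶜ)
    fun _ _ => hp.compl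
  have hset : {ω | ∀ l, ¬p (r l ω)} = ⋂ l ∈ (Finset.univ : Finset (Fin M)),
      r l ⁻¹' {v | p v}ᶜ := by
    ext ω
    simp
  rw [hset, measureReal_def, h, ENNReal.toReal_prod]
  have h2 : ∀ l, (P (r l ⁻¹' {v | p v}ᶜ)).toReal = 1 - (stdGaussian E).real {v | p v} := by
    intro l
    rw [← Measure.map_apply_of_aemeasurable (hlaw l).aemeasurable hp.compl, (hlaw l).map_eq,
      ← measureReal_def, probReal_compl_eq_one_sub hp]
  rw [Finset.prod_congr rfl fun l _ => h2 l]
  simp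

lemma one_sub_le_measureReal_success [IsProbabilityMeasure P] {n k : ℕ} {G : SimpleGraph (Fin n)} (hk0 : 0 < k)
    (hk : 2 * k ≤ n) {α ε : ℝ} (hα : α = (k : ℝ) / n) (hε : 0 < ε) (hε' : ε ≤ 0.000001)
    {y : Fin n → EuclideanSpace ℝ (Fin n)} (hy : SDPOptimal G α y) (K : ℕ)
    {r : Fin (K * numRounds α ε) → Ω → EuclideanSpace ℝ (Fin n)}
    (hlaw : ∀ l, HasLaw (r l) (stdGaussian (EuclideanSpace ℝ (Fin n))) P)
    (hind : iIndepFun r P) {T : Ω → Finset (Fin n)}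
    (hmeas : ∀ S, MeasurableSet {ω | T ω = S})
    (hT : ∀ᵐ ω ∂P, BestOfRounds G k y (fun l => r l ω) (T ω)) :
    1 - ε ^ K ≤ P.real {ω | (2 * gammaConst α ε - 1) / (1 - α) * opt G k ≤ index G (T ω)} := by
  have hn : (0 : ℝ) < n := by exact_mod_cast (by omega : 0 < n)
  have hk' : (0 : ℝ) < k := by exact_mod_cast hk0
  have hkn : 2 * (k : ℝ) ≤ n := by exact_mod_cast hk
  have h0 : 0 < α := by rw [hα]; positivity
  have h1 : α ≤ 1 / 2 := by rw [hα, div_le_div_iff₀ hn (by norm_num)]; linarith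
  have hgood := le_measureReal_goodSet hk0 hk hα hε.le hy
  have hbad := measureReal_forall_not_eq hlaw hind
    (measurableSet_hyperplaneRound y (GoodSet G k α ε))
  have hle : P.real {ω | ∀ l, ¬GoodSet G k α ε (hyperplaneRound y (r l ω))} ≤ ε ^ K := by
    rw [hbad, mul_comm, pow_mul]
    have : (stdGaussian (EuclideanSpace ℝ (Fin n))).real
      {r | GoodSet G k α ε (hyperplaneRound y r)} ≤ 1 := measureReal_le_one
    exact pow_le_pow_left₀ (pow_nonneg (by linarith) _)
      (pow_numRounds_le h0 (by linarith) hε hε' (by linarith) (by linarith)) K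
  have hsucc : MeasurableSet {ω | (2 * gammaConst α ε - 1) / (1 - α) * opt G k ≤
      index G (T ω)} := by
    have : {ω | (2 * gammaConst α ε - 1) / (1 - α) * opt G k ≤ (index G (T ω) : ℝ)} =
        ⋃ S ∈ {S | (2 * gammaConst α ε - 1) / (1 - α) * opt G k ≤ (index G S : ℝ)},
          {ω | T ω = S} := by
      ext ω
      simp
    rw [this]
    exact MeasurableSet.biUnion (Set.to_countable _) fun S _ => hmeas S
  have hcompl : P.real {ω | (2 * gammaConst α ε - 1) / (1 - α) * opt G k ≤ index G (T ω)}ᶜ ≤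
      P.real {ω | ∀ l, ¬GoodSet G k α ε (hyperplaneRound y (r l ω))} := by
    refine ENNReal.toReal_mono (measure_ne_top _ _) (measure_mono_ae ?_)
    filter_upwards [hT] with ω hω hfail l hl
    refine hfail ?_
    subst hα
    exact hω.le_index hk0 hk ⟨l, hl⟩
  rw [probReal_compl_eq_one_sub hsucc] at hcompl
  linarith

lemma mul_measureReal_le_integral_index [IsFiniteMeasure P] {n : ℕ} (G : SimpleGraph (Fin n))
    {T : Ω → Finset (Fin n)} (hmeas : ∀ S, MeasurableSet {ω | T ω = S}) (c : ℝ) :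
    c * P.real {ω | c ≤ index G (T ω)} ≤ ∫ ω, (index G (T ω) : ℝ) ∂P := by
  have hint : Integrable (fun ω => (index G (T ω) : ℝ)) P := by
    refine Integrable.of_bound (C := n) (Measurable.aestronglyMeasurable ?_)
      (.of_forall fun ω => ?_)
    · intro s _
      have : (fun ω => (index G (T ω) : ℝ)) ⁻¹' s =
          ⋃ S ∈ {S | (index G S : ℝ) ∈ s}, {ω | T ω = S} := by
        ext ω
        simp
      rw [this]
      exact MeasurableSet.biUnion (Set.to_countable _) fun S _ => hmeas S
    · rw [Real.norm_natCast]
      exact_mod_cast (Finset.card_le_univ _).trans (Fintype.card_fin n).le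
  exact mul_meas_ge_le_integral_of_nonneg (.of_forall fun ω => Nat.cast_nonneg _) hint c

end Amplification

end IntegrationMax

theorem mainTheorem4 :
    (0.878567 : ℝ) ≤ IntegrationMax.gwConst ∧
    (∃ ε₀ : ℝ, 0 < ε₀ ∧ ∀ ε : ℝ, 0 < ε → ε ≤ ε₀ →
      ∀ (n k : ℕ) (G : SimpleGraph (Fin n)), 0 < k → 2 * k ≤ n →
      ∀ α : ℝ, α = (k : ℝ) / n →
      ∀ y : Fin n → EuclideanSpace ℝ (Fin n), IntegrationMax.SDPOptimal G α y →
      ∀ K : ℕ, 1 ≤ K →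
      ∀ (Ω : Type*) [MeasurableSpace Ω] (P : Measure Ω) [IsProbabilityMeasure P]
        (r : Fin (K * IntegrationMax.numRounds α ε) → Ω → EuclideanSpace ℝ (Fin n)),
        (∀ l, HasLaw (r l) (stdGaussian (EuclideanSpace ℝ (Fin n))) P) →
        iIndepFun r P →
      ∀ T : Ω → Finset (Fin n), (∀ S, MeasurableSet {ω | T ω = S}) →
        (∀ᵐ ω ∂P, IntegrationMax.BestOfRounds G k y (fun l => r l ω) (T ω)) →
        1 - ε ^ K ≤ P.real {ω | IntegrationMax.ratio α ε * IntegrationMax.opt G k ≤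
            IntegrationMax.index G (T ω)} ∧
        IntegrationMax.ratio α ε * IntegrationMax.opt G k ≤
          ∫ ω, (IntegrationMax.index G (T ω) : ℝ) ∂P) ∧
    (∀ α ∈ Set.Icc (0.403 : ℝ) 0.5, ∀ ε : ℝ, 0 < ε → ε ≤ 1 / 1000 →
      1 / 2 < IntegrationMax.ratio α ε) := by
  refine ⟨IntegrationMax.gwConst_ge, ⟨0.000001, by norm_num, ?_⟩,
    fun α hα ε hε hε' => IntegrationMax.half_lt_ratio hα hε hε'⟩
  intro ε hε hε' n k G hk0 hk α hα y hy K hK Ω _ P _ r hlaw hind T hmeas hT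
  have hn : (0 : ℝ) < n := by exact_mod_cast (by omega : 0 < n)
  have hk' : (0 : ℝ) < k := by exact_mod_cast hk0
  have hkn : 2 * (k : ℝ) ≤ n := by exact_mod_cast hk
  have h0 : 0 < α := by rw [hα]; positivity
  have h1 : α ≤ 1 / 2 := by rw [hα, div_le_div_iff₀ hn (by norm_num)]; linarith
  have hmain := IntegrationMax.one_sub_le_measureReal_success hk0 hk hα hε hε' hy K hlaw hind
    hmeas hT
  have hexp := IntegrationMax.mul_measureReal_le_integral_index (P := P) G hmeas
    ((2 * IntegrationMax.gammaConst α ε - 1) / (1 - α) * IntegrationMax.opt G k)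
  rw [IntegrationMax.ratio_eq h0 (by linarith) (by linarith)]
  set q := (2 * IntegrationMax.gammaConst α ε - 1) / (1 - α)
  have hopt : (0 : ℝ) ≤ IntegrationMax.opt G k := Nat.cast_nonneg _
  -- For q ≥ 0, success at level q implies success at level q(1-ε), and Markov gives a mean of at
  -- least q(1-ε^K)·OPT. For q < 0 the claimed bounds are nonpositive.
  rcases le_or_gt 0 q with hq | hq
  · have hqo : 0 ≤ q * IntegrationMax.opt G k := mul_nonneg hq hopt
    constructor
    · refine hmain.trans (measureReal_mono fun ω hω => ?_)
      rw [Set.mem_ofPred_eq] at hω ⊢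
      refine le_trans ?_ hω
      nlinarith
    · have hKε : ε ^ K ≤ ε := pow_le_of_le_one hε.le (by linarith) (by omega)
      refine le_trans ?_ hexp
      rw [mul_right_comm]
      gcongr
      linarith
  · have hneg : q * (1 - ε) * IntegrationMax.opt G k ≤ 0 :=
      mul_nonpos_of_nonpos_of_nonneg
        (mul_nonpos_of_nonpos_of_nonneg hq.le (by linarith)) hopt
    constructor
    · have : {ω | q * (1 - ε) * IntegrationMax.opt G k ≤ IntegrationMax.index G (T ω)} =
          Set.univ := Set.eq_univ_of_forall fun ω => hneg.trans (Nat.cast_nonneg _)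
      rw [this, probReal_univ]
      have : 0 ≤ ε ^ K := by positivity
      linarith
    · exact hneg.trans (integral_nonneg fun ω => Nat.cast_nonneg _)
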